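/- Let $R$ and $S$ be associative rings with unity (not necessarily commutative). Modules are left modules, and right modules are left modules over the opposite ring. Let $K$ be a semidualizing $(S,R)$-bimodule, that is: ${}_SK$ and $K_R$ each admit a projective resolution by finitely generated projective modules over $S$, respectively $R^{op}$; the homothety maps $S\to \mathrm{Hom}_{R^{op}}(K,K)$, $s\mapsto (k\mapsto sk)$, and $R\to\mathrm{Hom}_S(K,K)$, $r\mapsto (k\mapsto kr)$, are bijective; and $\mathrm{Ext}^i_S(K,K)=0=\mathrm{Ext}^i_{R^{op}}(K,K)$ for all $i\ge 1$. (In particular, $K$ may be a special semidualizing bimodule $K_{d-1}$, i.e. a $(d-1)$th syzygy, that is semidualizing, of a super finitely presented $(S,R)$-bimodule $C$.) The Auslander class $\mathcal A_K(R)$ consists of the $R$-modules $M$ such that $\mathrm{Tor}^R_i(K,M)=0$ and $\mathrm{Ext}^i_S(K,K\otimes_RM)=0$ for all $i\ge 1$, and the natural map $M\to\mathrm{Hom}_S(K,K\otimes_R M)$, $m\mapsto(k\mapsto k\otimes m)$, is an isomorphism. The Bass class $\mathcal B_K(S)$ consists of the $S$-modules $N$ such that $\mathrm{Ext}^i_S(K,N)=0$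 and $\mathrm{Tor}^R_i(K,\mathrm{Hom}_S(K,N))=0$ for all $i\ge1$, and the natural map $K\otimes_R\mathrm{Hom}_S(K,N)\to N$, $k\otimes f\mapsto f(k)$, is an isomorphism. Regarding $K$ as an $(R^{op},S^{op})$-bimodule, one has in the same way the classes $\mathcal B_K(R^{op})$ and $\mathcal A_K(S^{op})$. For a module $X$ let $X^*=\mathrm{Hom}_{\mathbb Z}(X,\mathbb Q/\mathbb Z)$ be its character module, a module over the opposite ring. Then: 1. for every $R$-module $M$: $M\in\mathcal A_K(R)$ if and only if $M^*\in\mathcal B_K(R^{op})$; 2. for every $S$-module $N$: $N\in\mathcal B_K(S)$ if and only if $N^*\in\mathcal A_K(S^{op})$. -/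

import Mathlib

open CategoryTheory TensorProduct MulOpposite

universe u

/-!
Conventions.  Rings are associative with unit.  A right `R`-module is a (left) module over `Rᵐᵒᵖ`,
so `op r • k` is the right multiple `k r`.  An `(S, R)`-bimodule is an abelian group `K` with
`[Module S K] [Module Rᵐᵒᵖ K] [SMulCommClass S Rᵐᵒᵖ K]`.
-/

namespace Semidual

section Opposite

/-- A left `S`-module is a right `Sᵐᵒᵖ`-module, i.e. a left `Sᵐᵒᵖᵐᵒᵖ`-module. -/
instance opOpModule (S : Type*) (K : Type*) [Ring S] [AddCommGroup K] [Module S K] :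
    Module Sᵐᵒᵖᵐᵒᵖ K :=
  Module.compHom K ((RingEquiv.opOp S).symm : Sᵐᵒᵖᵐᵒᵖ →+* S)

theorem opOp_smul {S K : Type*} [Ring S] [AddCommGroup K] [Module S K] (s : Sᵐᵒᵖᵐᵒᵖ) (k : K) :
    s • k = s.unop.unop • k := rfl

/-- An `(S, R)`-bimodule is an `(Rᵐᵒᵖ, Sᵐᵒᵖ)`-bimodule. -/
instance opOp_smulCommClass (S R : Type*) (K : Type*) [Ring S] [Ring R] [AddCommGroup K]
    [Module S K] [Module Rᵐᵒᵖ K] [SMulCommClass S Rᵐᵒᵖ K] :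
    SMulCommClass Rᵐᵒᵖ Sᵐᵒᵖᵐᵒᵖ K where
  smul_comm r s k := (smul_comm s.unop.unop r k).symm

/-- The character module `M^* = Hom_ℤ(M, ℚ/ℤ)` of a left `R`-module `M` is a right `R`-module
through `(f r)(m) = f (r m)`. -/
instance characterModuleOp (R : Type*) (M : Type*) [Ring R] [AddCommGroup M] [Module R M] :
    Module Rᵐᵒᵖ (CharacterModule M) where
  smul r f := (f : M →+ AddCircle (1 : ℚ)).comp (DistribSMul.toAddMonoidHom M r.unop)
  one_smul f := CharacterModule.ext M fun m => congrArg f (one_smul R m)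
  mul_smul r s f := CharacterModule.ext M fun m => congrArg f (mul_smul s.unop r.unop m)
  smul_zero _ := rfl
  smul_add _ _ _ := rfl
  add_smul r s f := CharacterModule.ext M fun m =>
    (congrArg f (add_smul r.unop s.unop m)).trans (map_add f _ _)
  zero_smul f := CharacterModule.ext M fun m => (congrArg f (zero_smul R m)).trans (map_zero f)

theorem characterModule_op_smul_apply {R M : Type*} [Ring R] [AddCommGroup M] [Module R M]
    (r : Rᵐᵒᵖ) (f : CharacterModule M) (m : M) : (r • f) m = f (r.unop • m) := rfl

end Opposite

section Multiplication

variable (S R K : Type*) [Ring S] [Ring R] [AddCommGroup K] [Module S K] [Module Rᵐᵒᵖ K]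
  [SMulCommClass S Rᵐᵒᵖ K]

/-- Left multiplication `k ↦ s k` on an `(S, R)`-bimodule, a map of right `R`-modules. -/
def leftMul (s : S) : K →ₗ[Rᵐᵒᵖ] K where
  toFun k := s • k
  map_add' := smul_add s
  map_smul' r k := smul_comm s r k

/-- Right multiplication `k ↦ k r` on an `(S, R)`-bimodule, a map of left `S`-modules. -/
def rightMul (r : R) : K →ₗ[S] K where
  toFun k := op r • k
  map_add' := smul_add (op r)
  map_smul' s k := (smul_comm s (op r) k).symm

end Multiplication

section Tensor

variable (R : Type u) [Ring R]

/-- The subgroup of `K ⊗_ℤ M` generated by the elements `k r ⊗ m - k ⊗ r m`. -/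
def balancedRel (K M : Type u) [AddCommGroup K] [Module Rᵐᵒᵖ K] [AddCommGroup M] [Module R M] :
    Submodule ℤ (K ⊗[ℤ] M) :=
  Submodule.span ℤ {x | ∃ (k : K) (r : R) (m : M), x = (op r • k) ⊗ₜ[ℤ] m - k ⊗ₜ[ℤ] (r • m)}

/-- The tensor product `K ⊗_R M` of a right `R`-module `K` and a left `R`-module `M`,
an abelian group. -/
def BTensor (K M : Type u) [AddCommGroup K] [Module Rᵐᵒᵖ K] [AddCommGroup M] [Module R M] :
    Type u :=
  (K ⊗[ℤ] M) ⧸ balancedRel R K M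

namespace BTensor

variable {K K' K'' M : Type u} [AddCommGroup K] [Module Rᵐᵒᵖ K] [AddCommGroup K']
  [Module Rᵐᵒᵖ K'] [AddCommGroup K''] [Module Rᵐᵒᵖ K''] [AddCommGroup M] [Module R M]

instance : AddCommGroup (BTensor R K M) :=
  inferInstanceAs (AddCommGroup ((K ⊗[ℤ] M) ⧸ balancedRel R K M))

/-- The pure tensor `k ⊗ m`. -/
def tmul (k : K) (m : M) : BTensor R K M := (balancedRel R K M).mkQ (k ⊗ₜ[ℤ] m)

theorem tmul_add (k : K) (m m' : M) : tmul R k (m + m') = tmul R k m + tmul R k m' := by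
  unfold tmul
  rw [TensorProduct.tmul_add, map_add]
  rfl

theorem add_tmul (k k' : K) (m : M) : tmul R (k + k') m = tmul R k m + tmul R k' m := by
  unfold tmul
  rw [TensorProduct.add_tmul, map_add]
  rfl

theorem op_smul_tmul (k : K) (r : R) (m : M) : tmul R (op r • k) m = tmul R k (r • m) :=
  (Submodule.Quotient.eq (balancedRel R K M)).mpr (Submodule.subset_span ⟨k, r, m, rfl⟩)

/-- The homomorphism out of `K ⊗_R M` given by an `R`-balanced biadditive map. -/
def lift {A : Type*} [AddCommGroup A] (f : K →+ M →+ A)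
    (hf : ∀ (k : K) (r : R) (m : M), f (op r • k) m = f k (r • m)) : BTensor R K M →+ A :=
  QuotientAddGroup.lift (balancedRel R K M).toAddSubgroup
    (TensorProduct.liftAddHom f fun n k m => by
      rw [map_zsmul, map_zsmul, AddMonoidHom.zsmul_apply]) (by
    intro x hx
    change x ∈ balancedRel R K M at hx
    induction hx using Submodule.span_induction with
    | mem x h =>
      obtain ⟨k, r, m, rfl⟩ := h
      rw [AddMonoidHom.mem_ker, map_sub, sub_eq_zero]
      exact hf k r m
    | zero => exact zero_mem _
    | add x y _ _ hx hy => exact add_mem hx hy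
    | smul n x _ hx => exact zsmul_mem hx n)

theorem lift_tmul {A : Type*} [AddCommGroup A] (f : K →+ M →+ A)
    (hf : ∀ (k : K) (r : R) (m : M), f (op r • k) m = f k (r • m)) (k : K) (m : M) :
    lift R f hf (tmul R k m) = f k m := rfl

variable {R}

theorem induction_on {p : BTensor R K M → Prop} (x : BTensor R K M) (h0 : p 0)
    (ht : ∀ k m, p (tmul R k m)) (ha : ∀ x y, p x → p y → p (x + y)) : p x := by
  obtain ⟨y, rfl⟩ := (balancedRel R K M).mkQ_surjective x
  induction y using TensorProduct.induction_on with
  | zero => rw [map_zero]; exact h0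
  | tmul k m => exact ht k m
  | add a b iha ihb => rw [map_add]; exact ha _ _ iha ihb

theorem hom_ext {A : Type*} [AddCommGroup A] {f g : BTensor R K M →+ A}
    (h : ∀ k m, f (tmul R k m) = g (tmul R k m)) : f = g := by
  ext x
  induction x using induction_on with
  | h0 => simp
  | ht k m => exact h k m
  | ha x y hx hy => rw [map_add, map_add, hx, hy]

variable (M)

/-- The homomorphism `f ⊗ M : K ⊗_R M → K' ⊗_R M`. -/
def map (f : K →ₗ[Rᵐᵒᵖ] K') : BTensor R K M →+ BTensor R K' M :=
  lift R
    (AddMonoidHom.mk' (fun k => AddMonoidHom.mk' (fun m => tmul R (f k) m) fun m m' =>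
        tmul_add R (f k) m m')
      fun k k' => by ext m; simp [add_tmul])
    (fun k r m => by simp [op_smul_tmul])

@[simp] theorem map_tmul (f : K →ₗ[Rᵐᵒᵖ] K') (k : K) (m : M) :
    map M f (tmul R k m) = tmul R (f k) m := rfl

theorem map_id : map M (LinearMap.id : K →ₗ[Rᵐᵒᵖ] K) = AddMonoidHom.id (BTensor R K M) :=
  hom_ext fun _ _ => rfl

theorem map_comp (g : K' →ₗ[Rᵐᵒᵖ] K'') (f : K →ₗ[Rᵐᵒᵖ] K') :
    map M (g.comp f) = (map M g).comp (map M f) :=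
  hom_ext fun _ _ => rfl

theorem map_add_map (f g : K →ₗ[Rᵐᵒᵖ] K') : map M (f + g) = map M f + map M g :=
  hom_ext fun k m => by simp [add_tmul]

theorem map_zero_map : map M (0 : K →ₗ[Rᵐᵒᵖ] K') = 0 :=
  hom_ext fun k m => by
    have h := add_tmul R (0 : K') 0 m
    rw [add_zero, left_eq_add] at h
    simpa using h

/-- For an `(S, R)`-bimodule `K`, the group `K ⊗_R M` is a left `S`-module through
`s (k ⊗ m) = (s k) ⊗ m`. -/
instance leftModule {S : Type u} [Ring S] [Module S K] [SMulCommClass S Rᵐᵒᵖ K] :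
    Module S (BTensor R K M) where
  smul s x := map M (leftMul S R K s) x
  one_smul x := by
    change map M (leftMul S R K 1) x = x
    rw [show leftMul S R K 1 = LinearMap.id from LinearMap.ext fun k => one_smul S k]
    exact DFunLike.congr_fun (map_id M) x
  mul_smul s t x := by
    change map M (leftMul S R K (s * t)) x = _
    rw [show leftMul S R K (s * t) = (leftMul S R K s).comp (leftMul S R K t) from
      LinearMap.ext fun k => mul_smul s t k]
    exact DFunLike.congr_fun (map_comp M _ _) x
  smul_zero s := (map M (leftMul S R K s)).map_zero
  smul_add s := (map M (leftMul S R K s)).map_add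
  add_smul s t x := by
    change map M (leftMul S R K (s + t)) x = _
    rw [show leftMul S R K (s + t) = leftMul S R K s + leftMul S R K t from
      LinearMap.ext fun k => add_smul s t k]
    exact DFunLike.congr_fun (map_add_map M _ _) x
  zero_smul x := by
    change map M (leftMul S R K 0) x = 0
    rw [show leftMul S R K 0 = 0 from LinearMap.ext fun k => zero_smul S k]
    exact DFunLike.congr_fun (map_zero_map M) x

theorem smul_tmul {S : Type u} [Ring S] [Module S K] [SMulCommClass S Rᵐᵒᵖ K] (s : S) (k : K)
    (m : M) : s • tmul R k m = tmul R (s • k) m := rfl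

end BTensor

/-- The functor `- ⊗_R M` from right `R`-modules to abelian groups. -/
def tensorFunctor (M : Type u) [AddCommGroup M] [Module R M] :
    ModuleCat.{u} Rᵐᵒᵖ ⥤ AddCommGrpCat.{u} where
  obj K := AddCommGrpCat.of (BTensor R K M)
  map f := AddCommGrpCat.ofHom (BTensor.map M f.hom)
  map_id K := by
    rw [ModuleCat.hom_id, BTensor.map_id]
    rfl
  map_comp f g := by
    rw [ModuleCat.hom_comp, BTensor.map_comp]
    rfl

instance (M : Type u) [AddCommGroup M] [Module R M] : (tensorFunctor R M).Additive where
  map_add {_ _ f g} := by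
    change AddCommGrpCat.ofHom (BTensor.map M (f + g).hom) = _
    rw [ModuleCat.hom_add, BTensor.map_add_map]
    rfl

/-- `Tor_i^R(K, M)` for a right `R`-module `K` and a left `R`-module `M`: the `i`-th left derived
functor of `- ⊗_R M`, evaluated at `K`. -/
noncomputable def TorGroup (K M : Type u) [AddCommGroup K] [Module Rᵐᵒᵖ K] [AddCommGroup M]
    [Module R M] (i : ℕ) : AddCommGrpCat.{u} :=
  ((tensorFunctor R M).leftDerived i).obj (ModuleCat.of Rᵐᵒᵖ K)

end Tensor

/-- `Ext_S^i(K, N)` for left `S`-modules `K` and `N`. -/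
abbrev ExtGroup (S : Type u) [Ring S] (K N : Type u) [AddCommGroup K] [Module S K]
    [AddCommGroup N] [Module S N] (i : ℕ) : Type u :=
  Abelian.Ext.{u} (ModuleCat.of S K) (ModuleCat.of S N) i

section Hom

/-- The group `Hom_S(K, N)`, for an `(S, R)`-bimodule `K` and a left `S`-module `N`, which will be
regarded as a left `R`-module. -/
def BHom (S : Type u) [Ring S] (K N : Type u) [AddCommGroup K] [Module S K] [AddCommGroup N]
    [Module S N] : Type u :=
  K →ₗ[S] N

variable (S R : Type u) [Ring S] [Ring R] (K N : Type u) [AddCommGroup K] [Module S K]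
  [Module Rᵐᵒᵖ K] [SMulCommClass S Rᵐᵒᵖ K] [AddCommGroup N] [Module S N]

instance : AddCommGroup (BHom S K N) := inferInstanceAs (AddCommGroup (K →ₗ[S] N))

instance : FunLike (BHom S K N) K N := inferInstanceAs (FunLike (K →ₗ[S] N) K N)

/-- `Hom_S(K, N)` is a left `R`-module through `(r f)(k) = f (k r)`. -/
instance BHom.leftModule : Module R (BHom S K N) where
  smul r f := LinearMap.comp (f : K →ₗ[S] N) (rightMul S R K r)
  one_smul f := LinearMap.ext fun k => congrArg f (one_smul Rᵐᵒᵖ k)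
  mul_smul r s f := LinearMap.ext fun k => congrArg f (mul_smul (op s) (op r) k)
  smul_zero _ := rfl
  smul_add _ _ _ := rfl
  add_smul r s f := LinearMap.ext fun k =>
    (congrArg f (add_smul (op r) (op s) k)).trans (LinearMap.map_add (f : K →ₗ[S] N) _ _)
  zero_smul f := LinearMap.ext fun k =>
    (congrArg f (zero_smul Rᵐᵒᵖ k)).trans (LinearMap.map_zero (f : K →ₗ[S] N))

theorem BHom.smul_apply (r : R) (f : BHom S K N) (k : K) : (r • f) k = f (op r • k) := rfl

/-- The natural evaluation homomorphism `μ_M : M → Hom_S(K, K ⊗_R M)`, `m ↦ (k ↦ k ⊗ m)`. -/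
def evalMu (M : Type u) [AddCommGroup M] [Module R M] : M →ₗ[R] BHom S K (BTensor R K M) where
  toFun m := show K →ₗ[S] BTensor R K M from
    { toFun := fun k => BTensor.tmul R k m
      map_add' := fun k k' => BTensor.add_tmul R k k' m
      map_smul' := fun _ _ => rfl }
  map_add' m m' := LinearMap.ext fun k => BTensor.tmul_add R k m m'
  map_smul' r m := LinearMap.ext fun k => (BTensor.op_smul_tmul R k r m).symm

/-- The natural evaluation homomorphism `ν_N : K ⊗_R Hom_S(K, N) → N`, `k ⊗ f ↦ f k`. -/
def evalNu : BTensor R K (BHom S K N) →ₗ[S] N where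
  toFun := BTensor.lift R
    (AddMonoidHom.mk' (fun k => AddMonoidHom.mk' (fun f : BHom S K N => f k) fun _ _ => rfl)
      fun k k' => by
        ext f
        exact LinearMap.map_add (show K →ₗ[S] N from f) k k')
    (fun _ _ _ => rfl)
  map_add' := map_add _
  map_smul' s x := by
    induction x using BTensor.induction_on with
    | h0 => simp
    | ht k f => exact LinearMap.map_smul (show K →ₗ[S] N from f) s k
    | ha x y hx hy =>
      rw [smul_add, map_add, map_add, hx, hy, smul_add]

theorem evalMu_apply (M : Type u) [AddCommGroup M] [Module R M] (m : M) (k : K) :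
    evalMu S R K M m k = BTensor.tmul R k m := rfl

theorem evalNu_tmul (k : K) (f : BHom S K N) : evalNu S R K N (BTensor.tmul R k f) = f k := rfl

end Hom

/-- The left `S`-module `K` has a projective resolution by finitely generated projective
modules. -/
def HasDegreewiseFiniteResolution (S : Type u) [Ring S] (K : Type u) [AddCommGroup K]
    [Module S K] : Prop :=
  ∃ P : ProjectiveResolution (ModuleCat.of S K), ∀ n : ℕ, Module.Finite S (P.complex.X n)

section Classes

variable (S R : Type u) [Ring S] [Ring R] (K : Type u) [AddCommGroup K] [Module S K]
  [Module Rᵐᵒᵖ K] [SMulCommClass S Rᵐᵒᵖ K]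

/-- The `(S, R)`-bimodule `K` is semidualizing. -/
structure IsSemidualizing : Prop where
  left_resolution : HasDegreewiseFiniteResolution S K
  right_resolution : HasDegreewiseFiniteResolution Rᵐᵒᵖ K
  /-- The homothety map `S → Hom_{R^op}(K, K)`, `s ↦ (k ↦ s k)`, is an isomorphism. -/
  left_homothety :
    Function.Bijective fun s : S => leftMul S R K s
  /-- The homothety map `R → Hom_S(K, K)`, `r ↦ (k ↦ k r)`, is an isomorphism. -/
  right_homothety :
    Function.Bijective fun r : R => rightMul S R K r
  left_ext : ∀ i : ℕ, 1 ≤ i → Subsingleton (ExtGroup S K K i)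
  right_ext : ∀ i : ℕ, 1 ≤ i → Subsingleton (ExtGroup Rᵐᵒᵖ K K i)

/-- The left `R`-module `M` belongs to the Auslander class `A_K(R)`, where `K` is an
`(S, R)`-bimodule. -/
structure IsAuslander (M : Type u) [AddCommGroup M] [Module R M] : Prop where
  tor_vanish : ∀ i : ℕ, 1 ≤ i → Limits.IsZero (TorGroup R K M i)
  ext_vanish : ∀ i : ℕ, 1 ≤ i → Subsingleton (ExtGroup S K (BTensor R K M) i)
  eval_iso : Function.Bijective (evalMu S R K M)

/-- The left `S`-module `N` belongs to the Bass class `B_K(S)`, where `K` is an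
`(S, R)`-bimodule. -/
structure IsBass (N : Type u) [AddCommGroup N] [Module S N] : Prop where
  ext_vanish : ∀ i : ℕ, 1 ≤ i → Subsingleton (ExtGroup S K N i)
  tor_vanish : ∀ i : ℕ, 1 ≤ i → Limits.IsZero (TorGroup R K (BHom S K N) i)
  eval_iso : Function.Bijective (evalNu S R K N)

end Classes

end Semidual

/-! Since `ℚ/ℤ` is an injective cogenerator of abelian groups, passing to characters preserves and
reflects both exactness and bijectivity. Two natural maps then exchange tensor and Hom. The
adjunction `curry : (P ⊗_R M)^* → Hom_{R^op}(P, M^*)` is always bijective. Tensor evaluation `theta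
: P ⊗_{S^op} N^* → Hom_S(P, N)^*` is bijective for finitely generated projective `P`, hence also for
finitely presented `P`.

Applied termwise to a projective resolution of `K`, of finite type in the second case, these maps
show that `Ext_{R^op}(K, M^*)` vanishes exactly when `Tor^R(K, M)` does, and `Tor^{S^op}(K, N^*)`
exactly when `Ext_S(K, N)` does. Applied to `K` itself, they identify the dual of `μ_M` with
`ν_{M^*}` and the dual of `ν_N` with `μ_{N^*}`. Thus each of the three conditions defining one class
is matched with a condition defining the other. -/

namespace Semidual

/-! ### Characters detect exactness and bijectivity -/

section Characters

variable {A B C : Type*} [AddCommGroup A] [AddCommGroup B] [AddCommGroup C]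

/-- Precomposition of characters with a homomorphism. -/
def dualHom (f : A →+ B) : CharacterModule B →+ CharacterModule A where
  toFun c := AddMonoidHom.comp (c : B →+ AddCircle (1 : ℚ)) f
  map_zero' := rfl
  map_add' _ _ := rfl

theorem dualHom_apply (f : A →+ B) (c : CharacterModule B) (a : A) : dualHom f c a = c (f a) := rfl

theorem dualHom_bijective_iff (f : A →+ B) :
    Function.Bijective (dualHom f) ↔ Function.Bijective f :=
  CharacterModule.dual_bijective_iff_bijective (f := f.toIntLinearMap)

theorem dualHom_surjective {f : A →+ B} (hf : Function.Injective f) :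
    Function.Surjective (dualHom f) :=
  CharacterModule.dual_surjective_of_injective f.toIntLinearMap hf

/-- A sequence of abelian groups is exact if and only if its character sequence is. -/
theorem exact_dualHom_iff (f : A →+ B) (g : B →+ C) :
    Function.Exact (dualHom g) (dualHom f) ↔ Function.Exact f g := by
  constructor
  · intro h b
    constructor
    · intro hb
      change b ∈ f.range
      rw [← QuotientAddGroup.eq_zero_iff]
      refine CharacterModule.eq_zero_of_character_apply fun c => ?_
      -- A character `c` of `B / im f`, pulled back to `B`, kills `im f`, so it has the form `d ∘ g`
      -- and vanishes at `b`. Such characters separate the points of `B / im f`.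
      obtain ⟨d, hd⟩ := (h (dualHom (QuotientAddGroup.mk' f.range) c)).1 <|
        CharacterModule.ext _ fun a => by
          have : QuotientAddGroup.mk' f.range (f a) = 0 :=
            (QuotientAddGroup.eq_zero_iff _).2 ⟨a, rfl⟩
          rw [dualHom_apply, dualHom_apply, this, map_zero]
          rfl
      have := DFunLike.congr_fun hd b
      rw [dualHom_apply, dualHom_apply, hb, map_zero] at this
      exact this.symm
    · rintro ⟨a, rfl⟩
      refine CharacterModule.eq_zero_of_character_apply fun c => ?_
      exact DFunLike.congr_fun ((h (dualHom g c)).2 ⟨c, rfl⟩) a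
  · intro h c
    constructor
    · intro hc
      -- As `c` kills `im f = ker g`, it descends to `B / ker g`, which embeds in `C`; injectivity
      -- of `ℚ/ℤ` extends it to `C`.
      obtain ⟨d, hd⟩ := dualHom_surjective
        (f := QuotientAddGroup.kerLift g) (QuotientAddGroup.kerLift_injective g)
        (QuotientAddGroup.lift g.ker (c : B →+ AddCircle (1 : ℚ)) fun b hb => by
          obtain ⟨a, rfl⟩ := (h b).1 hb
          exact DFunLike.congr_fun hc a)
      exact ⟨d, CharacterModule.ext _ fun b => DFunLike.congr_fun hd (b : B ⧸ g.ker)⟩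
    · rintro ⟨d, rfl⟩
      refine CharacterModule.ext _ fun a => ?_
      rw [dualHom_apply, dualHom_apply, (h (f a)).2 ⟨a, rfl⟩, map_zero]
      rfl

end Characters

/-! ### Exactness along isomorphisms -/

section ExactTransport

variable {A B C A' B' C' : Type*} [AddCommGroup A] [AddCommGroup B] [AddCommGroup C]
  [AddCommGroup A'] [AddCommGroup B'] [AddCommGroup C']

/-- Exactness is invariant under isomorphisms of sequences. -/
theorem exact_iff_of_bijective {f : A →+ B} {g : B →+ C} {f' : A' →+ B'} {g' : B' →+ C'}
    {α : A →+ A'} {β : B →+ B'} {γ : C →+ C'} (hα : Function.Bijective α)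
    (hβ : Function.Bijective β) (hγ : Function.Bijective γ) (hf : ∀ a, β (f a) = f' (α a))
    (hg : ∀ b, γ (g b) = g' (β b)) : Function.Exact f g ↔ Function.Exact f' g' :=
  (Function.Exact.iff_of_ladder_addEquiv (e₁ := AddEquiv.ofBijective α hα)
    (e₂ := AddEquiv.ofBijective β hβ) (e₃ := AddEquiv.ofBijective γ hγ)
    (AddMonoidHom.ext fun a => (hf a).symm) (AddMonoidHom.ext fun b => (hg b).symm)).symm

end ExactTransport

/-! ### The tensor-Hom adjunction for characters -/

section Curry

variable (R : Type u) [Ring R] {P P' : Type u} (M M' : Type u) [AddCommGroup P] [Module Rᵐᵒᵖ P]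
  [AddCommGroup P'] [Module Rᵐᵒᵖ P'] [AddCommGroup M] [Module R M] [AddCommGroup M'] [Module R M']

variable {R} in
/-- Precomposition with a linear map. -/
def precomp {P P' : Type*} [AddCommGroup P] [Module R P] [AddCommGroup P'] [Module R P']
    (f : P →ₗ[R] P') (N : Type*) [AddCommGroup N] [Module R N] : (P' →ₗ[R] N) →+ (P →ₗ[R] N) where
  toFun g := g.comp f
  map_zero' := rfl
  map_add' _ _ := rfl

variable (P) in
/-- The adjunction homomorphism `(P ⊗_R M)^* → Hom_{R^op}(P, M^*)`. -/
def curry : CharacterModule (BTensor R P M) →+ (P →ₗ[Rᵐᵒᵖ] CharacterModule M) where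
  toFun c :=
    { toFun := fun p => AddMonoidHom.mk' (fun m => c (BTensor.tmul R p m)) fun m m' => by
        rw [BTensor.tmul_add, map_add]
      map_add' := fun p p' => CharacterModule.ext _ fun m => by
        change c (BTensor.tmul R (p + p') m) = _
        rw [BTensor.add_tmul, map_add]
        rfl
      map_smul' := fun r p => CharacterModule.ext _ fun m =>
        congrArg c (BTensor.op_smul_tmul R p r.unop m) }
  map_zero' := rfl
  map_add' _ _ := rfl

variable (P) in
-- Both sides are the balanced biadditive maps `P × M → ℚ/ℤ`, so no finiteness of `P` is needed.
theorem curry_bijective : Function.Bijective (curry R P M) := by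
  constructor
  · intro c d h
    exact BTensor.hom_ext (f := c) (g := d) fun p m =>
      DFunLike.congr_fun (LinearMap.congr_fun h p) m
  · intro g
    exact ⟨BTensor.lift R (A := AddCircle (1 : ℚ)) (g.toAddMonoidHom : P →+ M →+ AddCircle (1 : ℚ))
      fun p r m => DFunLike.congr_fun (g.map_smul (op r) p) m, rfl⟩

theorem curry_dualHom_map (f : P →ₗ[Rᵐᵒᵖ] P') (c : CharacterModule (BTensor R P' M)) :
    curry R P M (dualHom (BTensor.map M f) c) = precomp f _ (curry R P' M c) := rfl

variable (P) {M M'} in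
/-- The homomorphism `P ⊗ g : P ⊗_R M → P ⊗_R M'`. -/
def lmap (g : M →ₗ[R] M') : BTensor R P M →+ BTensor R P M' :=
  BTensor.lift R
    (AddMonoidHom.mk' (fun p => AddMonoidHom.mk' (fun m => BTensor.tmul R p (g m)) fun m m' => by
        rw [map_add, BTensor.tmul_add])
      fun p p' => by ext m; exact BTensor.add_tmul R p p' (g m))
    (fun p r m => by
      change BTensor.tmul R _ _ = BTensor.tmul R _ _
      rw [BTensor.op_smul_tmul, map_smul])

variable {M M'} in
theorem lmap_tmul (g : M →ₗ[R] M') (p : P) (m : M) :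
    lmap R P g (BTensor.tmul R p m) = BTensor.tmul R p (g m) := rfl

variable (P) {M M'} in
theorem lmap_bijective (e : M ≃ₗ[R] M') :
    Function.Bijective (lmap R P (e : M →ₗ[R] M')) := by
  refine Function.bijective_iff_has_inverse.2 ⟨lmap R P (e.symm : M' →ₗ[R] M), fun x => ?_,
    fun x => ?_⟩
  · induction x using BTensor.induction_on with
    | h0 => rw [map_zero, map_zero]
    | ht p m => simp [lmap_tmul]
    | ha x y hx hy => rw [map_add, map_add, hx, hy]
  · induction x using BTensor.induction_on with
    | h0 => rw [map_zero, map_zero]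
    | ht p m => simp [lmap_tmul]
    | ha x y hx hy => rw [map_add, map_add, hx, hy]

theorem map_surjective {f : P →ₗ[Rᵐᵒᵖ] P'} (hf : Function.Surjective f) :
    Function.Surjective (BTensor.map M f) := by
  intro x
  induction x using BTensor.induction_on with
  | h0 => exact ⟨0, map_zero _⟩
  | ht p m =>
    obtain ⟨p, rfl⟩ := hf p
    exact ⟨BTensor.tmul R p m, rfl⟩
  | ha x y hx hy =>
    obtain ⟨x, rfl⟩ := hx
    obtain ⟨y, rfl⟩ := hy
    exact ⟨x + y, map_add _ _ _⟩

end Curry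

/-! ### Tensor evaluation -/

section TensorEvaluation

variable {S : Type u} [Ring S]

/-- A map of left `S`-modules, as a map of right `S^op`-modules. -/
def opOpLin {P P' : Type*} [AddCommGroup P] [Module S P] [AddCommGroup P'] [Module S P']
    (f : P →ₗ[S] P') : P →ₗ[Sᵐᵒᵖᵐᵒᵖ] P' where
  toFun := f
  map_add' := map_add f
  map_smul' s p := map_smul f s.unop.unop p

variable {P P' P'' : Type u} [AddCommGroup P] [Module S P] [AddCommGroup P'] [Module S P']
  [AddCommGroup P''] [Module S P''] (N : Type u) [AddCommGroup N] [Module S N]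

variable (S P) in
/-- The tensor evaluation homomorphism `P ⊗_{S^op} N^* → Hom_S(P, N)^*`,
`p ⊗ c ↦ (f ↦ c (f p))`. -/
def theta : BTensor Sᵐᵒᵖ P (CharacterModule N) →+ CharacterModule (P →ₗ[S] N) :=
  BTensor.lift Sᵐᵒᵖ
    (AddMonoidHom.mk' (fun p => AddMonoidHom.mk' (fun c =>
        (AddMonoidHom.mk' (fun f : P →ₗ[S] N => c (f p)) fun f g => map_add c _ _ :
          (P →ₗ[S] N) →+ AddCircle (1 : ℚ))) fun c d => rfl)
      fun p p' => by
        ext c f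
        change c (f (p + p')) = c (f p) + c (f p')
        rw [map_add, map_add])
    (fun p s c => CharacterModule.ext _ fun f => congrArg c (f.map_smul s.unop p))

theorem theta_map (f : P →ₗ[S] P') (x : BTensor Sᵐᵒᵖ P (CharacterModule N)) :
    theta S P' N (BTensor.map _ (opOpLin f) x) = dualHom (precomp f N) (theta S P N x) := by
  induction x using BTensor.induction_on with
  | h0 => simp
  | ht p c => rfl
  | ha x y hx hy => rw [map_add, map_add, map_add, map_add, hx, hy]

variable (S P) in
/-- Tensor evaluation is bijective for finitely generated projective modules. -/
theorem theta_bijective_of_projective [Module.Finite S P] [Module.Projective S P] :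
    Function.Bijective (theta S P N) := by
  obtain ⟨n, π, hπ⟩ := Module.Finite.exists_fin' S P
  obtain ⟨σ, hσ⟩ := Module.projective_lifting_property π LinearMap.id hπ
  -- A splitting `σ` of `π` gives a dual basis of `P`: generators `b i` and coordinate forms `φ i`.
  let b : Fin n → P := fun i => π (Pi.single i 1)
  let φ : Fin n → P →ₗ[S] S := fun i => (LinearMap.proj i).comp σ
  have hb : ∀ p, ∑ i, φ i p • b i = p := fun p => by
    have h : π (σ p) = p := LinearMap.congr_fun hσ p
    conv_rhs => rw [← h, pi_eq_sum_univ' (σ p), map_sum]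
    refine Finset.sum_congr rfl fun i _ => ?_
    rw [map_smul]
    congr 2
  let ρ : Fin n → N →+ (P →ₗ[S] N) := fun i =>
    AddMonoidHom.mk' (fun x => (φ i).smulRight x) fun x y => LinearMap.ext fun p => smul_add _ _ _
  -- The inverse is forced by the dual basis: `g ↦ ∑ b i ⊗ (x ↦ g (φ i (-) x))`.
  let inv : CharacterModule (P →ₗ[S] N) →+ BTensor Sᵐᵒᵖ P (CharacterModule N) :=
    AddMonoidHom.mk' (fun g => ∑ i, BTensor.tmul Sᵐᵒᵖ (b i) (dualHom (ρ i) g))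
      fun g h => by
        rw [← Finset.sum_add_distrib]
        exact Finset.sum_congr rfl fun i _ => by rw [map_add, BTensor.tmul_add]
  refine Function.bijective_iff_has_inverse.2 ⟨inv, fun x => ?_, fun g => ?_⟩
  · induction x using BTensor.induction_on with
    | h0 => rw [map_zero, map_zero]
    | ht p c =>
      change ∑ i, BTensor.tmul Sᵐᵒᵖ (b i) (dualHom (ρ i) (theta S P N (BTensor.tmul Sᵐᵒᵖ p c))) = _
      -- Here the character is `x ↦ c (φ i p • x)`; the scalar `φ i p` moves across the tensor sign
      -- onto `b i`.
      have h : ∀ i, BTensor.tmul Sᵐᵒᵖ (b i)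
          (dualHom (ρ i) (theta S P N (BTensor.tmul Sᵐᵒᵖ p c))) =
          BTensor.tmul Sᵐᵒᵖ (φ i p • b i) c := fun i =>
        (BTensor.op_smul_tmul Sᵐᵒᵖ (b i) (op (φ i p)) c).symm
      conv_rhs => rw [← hb p]
      rw [Finset.sum_congr rfl fun i _ => h i]
      exact (map_sum (AddMonoidHom.mk' (fun p => BTensor.tmul Sᵐᵒᵖ p c) fun p p' =>
        BTensor.add_tmul Sᵐᵒᵖ p p' c) _ _).symm
    | ha x y hx hy => rw [map_add, map_add, hx, hy]
  · refine CharacterModule.ext _ fun f => ?_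
    change theta S P N (∑ i, BTensor.tmul Sᵐᵒᵖ (b i) (dualHom (ρ i) g)) f = g f
    have hf : ∑ i, ρ i (f (b i)) = f := LinearMap.ext fun p => by
      conv_rhs => rw [← hb p, map_sum]
      rw [LinearMap.sum_apply]
      exact Finset.sum_congr rfl fun i _ => (f.map_smul _ _).symm
    conv_rhs => rw [← hf, map_sum]
    rw [map_sum]
    exact map_sum (AddMonoidHom.mk' (fun c : CharacterModule (P →ₗ[S] N) => c f)
      fun _ _ => rfl) _ _

/-- Tensor evaluation is bijective for finitely presented modules. -/
theorem theta_bijective_of_presentation {d : P →ₗ[S] P'} {π : P' →ₗ[S] P''}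
    (hd : Function.Exact d π) (hπ : Function.Surjective π)
    (hP : Function.Bijective (theta S P N)) (hP' : Function.Bijective (theta S P' N)) :
    Function.Bijective (theta S P'' N) := by
  have hinj : Function.Injective (precomp π N) := fun f g h =>
    LinearMap.ext fun p => by
      obtain ⟨p, rfl⟩ := hπ p
      exact LinearMap.congr_fun h p
  -- Left exactness of `Hom_S(-, N)`. Dualizing it gives an exact row to compare with the right
  -- exact `- ⊗ N^*`.
  have hex : Function.Exact (precomp π N) (precomp d N) := by
    intro f
    constructor
    · intro hf
      have hker : LinearMap.ker π ≤ LinearMap.ker f := fun p hp => by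
        obtain ⟨q, rfl⟩ := (hd p).1 hp
        exact LinearMap.congr_fun hf q
      refine ⟨((LinearMap.ker π).liftQ f hker).comp
        (π.quotKerEquivOfSurjective hπ).symm.toLinearMap, LinearMap.ext fun p => ?_⟩
      change (LinearMap.ker π).liftQ f hker ((π.quotKerEquivOfSurjective hπ).symm (π p)) = f p
      rw [show (π.quotKerEquivOfSurjective hπ).symm (π p) = (LinearMap.ker π).mkQ p from
        (LinearEquiv.symm_apply_eq _).2 rfl]
      rfl
    · rintro ⟨g, rfl⟩
      refine LinearMap.ext fun p => ?_
      change g (π (d p)) = 0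
      rw [(hd (d p)).2 ⟨p, rfl⟩, map_zero]
  have hex' := (exact_dualHom_iff _ _).2 hex
  constructor
  · rw [injective_iff_map_eq_zero]
    intro x hx
    -- Lift `x` to `y` over `P'`. Then `theta y` comes from `Hom(P, N)^*`, so `y` comes from `P ⊗
    -- N^*`, and its image `x` vanishes because `π ∘ d = 0`.
    obtain ⟨y, rfl⟩ := map_surjective Sᵐᵒᵖ _ (f := opOpLin π) hπ x
    rw [theta_map] at hx
    obtain ⟨z, hz⟩ := (hex' _).1 hx
    obtain ⟨z, rfl⟩ := hP.2 z
    rw [← theta_map] at hz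
    rw [← hP'.1 hz]
    change ((BTensor.map _ (opOpLin π)).comp (BTensor.map _ (opOpLin d))) z = 0
    rw [← BTensor.map_comp, show (opOpLin π).comp (opOpLin d) = 0 from
      LinearMap.ext fun p => (hd (d p)).2 ⟨p, rfl⟩, BTensor.map_zero_map]
    rfl
  · intro c
    obtain ⟨c, rfl⟩ := dualHom_surjective hinj c
    obtain ⟨y, rfl⟩ := hP'.2 c
    exact ⟨_, theta_map N π y⟩

end TensorEvaluation

/-! ### Vanishing of Tor and Ext under duality -/

section Derived

/-- Vanishing of `Tor` in positive degree, in terms of a projective resolution. -/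
theorem isZero_torGroup_iff (R : Type u) [Ring R] (K M : Type u) [AddCommGroup K] [Module Rᵐᵒᵖ K]
    [AddCommGroup M] [Module R M] (P : ProjectiveResolution (ModuleCat.of Rᵐᵒᵖ K)) (i : ℕ) :
    Limits.IsZero (TorGroup R K M (i + 1)) ↔
      Function.Exact (BTensor.map M (P.complex.d (i + 2) (i + 1)).hom)
        (BTensor.map M (P.complex.d (i + 1) i).hom) := by
  -- The resolution is arbitrary, which later allows one of finite type. In degree `i + 1` both
  -- adjacent differentials belong to the resolution.
  have e := P.isoLeftDerivedObj (tensorFunctor R M) (i + 1)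
  refine e.isZero_iff.trans ?_
  change Limits.IsZero (HomologicalComplex.homology _ (i + 1)) ↔ _
  rw [← HomologicalComplex.exactAt_iff_isZero_homology,
    HomologicalComplex.exactAt_iff' _ (i + 2) (i + 1) i (by simp only [ChainComplex.prev]; rfl)
      (by simp), ShortComplex.ab_exact_iff_function_exact]
  rfl

/-- Vanishing of `Ext` in positive degree, in terms of a projective resolution. -/
theorem subsingleton_extGroup_iff (S : Type u) [Ring S] (K N : Type u) [AddCommGroup K]
    [Module S K] [AddCommGroup N] [Module S N] (P : ProjectiveResolution (ModuleCat.of S K))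
    (i : ℕ) :
    Subsingleton (ExtGroup S K N (i + 1)) ↔
      Function.Exact (precomp (P.complex.d (i + 1) i).hom N)
        (precomp (P.complex.d (i + 2) (i + 1)).hom N) := by
  constructor
  · intro h f
    constructor
    · intro hf
      have hf' : P.complex.d (i + 2) (i + 1) ≫ ModuleCat.ofHom f = 0 := ModuleCat.hom_ext hf
      -- A cocycle represents zero in Ext exactly when it factors through the preceding
      -- differential.
      obtain ⟨g, hg⟩ := (P.extMk_eq_zero_iff (ModuleCat.ofHom f) (i + 2) rfl hf' i rfl).1
        (Subsingleton.elim _ _)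
      exact ⟨g.hom, congrArg ModuleCat.Hom.hom hg⟩
    · rintro ⟨g, rfl⟩
      have := congrArg ModuleCat.Hom.hom (P.complex.d_comp_d (i + 2) (i + 1) i)
      exact LinearMap.ext fun x => (congrArg g (LinearMap.congr_fun this x)).trans (map_zero g)
  · intro h
    refine subsingleton_of_forall_eq 0 fun α => ?_
    obtain ⟨f, hf, rfl⟩ := P.extMk_surjective α (i + 2) rfl
    refine (P.extMk_eq_zero_iff f (i + 2) rfl hf i rfl).2 ?_
    obtain ⟨g, hg⟩ := (h f.hom).1 (congrArg ModuleCat.Hom.hom hf)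
    exact ⟨ModuleCat.ofHom g, ModuleCat.hom_ext hg⟩

variable (S : Type u) [Ring S]

/-- Left `S`-modules as left `S^opop`-modules. -/
noncomputable abbrev opOpFunctor : ModuleCat.{u} S ⥤ ModuleCat.{u} Sᵐᵒᵖᵐᵒᵖ :=
  ModuleCat.restrictScalars (RingEquiv.opOp S).symm.toRingHom

/-- Restriction along a ring isomorphism is an equivalence of categories. -/
instance : (opOpFunctor S).PreservesProjectiveObjects where
  projective_obj hX :=
    ((ModuleCat.restrictScalarsEquivalenceOfRingEquiv
      (RingEquiv.opOp S).symm).map_projective_iff _).2 hX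

/-- A projective resolution over `S`, as a projective resolution over `S^opop`. -/
noncomputable def opOpResolution {K : Type u} [AddCommGroup K] [Module S K]
    (P : ProjectiveResolution (ModuleCat.of S K)) :
    ProjectiveResolution (ModuleCat.of Sᵐᵒᵖᵐᵒᵖ K) :=
  (opOpFunctor S).mapProjectiveResolution P

/-- `Tor_i^R(K, M)` vanishes if and only if `Ext^i_{R^op}(K, M^*)` does. -/
theorem subsingleton_extGroup_characterModule_iff (R : Type u) [Ring R] (K M : Type u)
    [AddCommGroup K] [Module Rᵐᵒᵖ K] [AddCommGroup M] [Module R M] (i : ℕ) :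
    Subsingleton (ExtGroup Rᵐᵒᵖ K (CharacterModule M) (i + 1)) ↔
      Limits.IsZero (TorGroup R K M (i + 1)) := by
  let P := projectiveResolution (ModuleCat.of Rᵐᵒᵖ K)
  rw [subsingleton_extGroup_iff Rᵐᵒᵖ K _ P, isZero_torGroup_iff R K M P]
  refine Iff.trans (Iff.symm ?_) (exact_dualHom_iff _ _)
  exact exact_iff_of_bijective (curry_bijective R _ M) (curry_bijective R _ M)
    (curry_bijective R _ M) (curry_dualHom_map R M _) (curry_dualHom_map R M _)

/-- If `K` has a resolution by finitely generated projective modules, then `Tor_i^{S^op}(K, N^*)`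
vanishes if and only if `Ext^i_S(K, N)` does. -/
theorem isZero_torGroup_characterModule_iff {K : Type u} (N : Type u) [AddCommGroup K] [Module S K]
    [AddCommGroup N] [Module S N] (hK : HasDegreewiseFiniteResolution S K) (i : ℕ) :
    Limits.IsZero (TorGroup Sᵐᵒᵖ K (CharacterModule N) (i + 1)) ↔
      Subsingleton (ExtGroup S K N (i + 1)) := by
  obtain ⟨P, hP⟩ := hK
  have hproj : ∀ n, Module.Projective S (P.complex.X n) := fun n =>
    (IsProjective.iff_projective _).2 (P.projective n)
  have hθ := fun n => theta_bijective_of_projective S (P.complex.X n) N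
  rw [subsingleton_extGroup_iff S K N P, isZero_torGroup_iff Sᵐᵒᵖ K _ (opOpResolution S P)]
  refine Iff.trans ?_ (exact_dualHom_iff _ _)
  -- The transported resolution has the same underlying differentials.
  change Function.Exact (BTensor.map _ (opOpLin (P.complex.d (i + 2) (i + 1)).hom))
    (BTensor.map _ (opOpLin (P.complex.d (i + 1) i).hom)) ↔ _
  exact exact_iff_of_bijective (hθ (i + 2)) (hθ (i + 1)) (hθ i) (theta_map N _) (theta_map N _)

/-- The last two terms of the resolution form a finite presentation of `K`. -/
theorem theta_bijective {K : Type u} (N : Type u) [AddCommGroup K] [Module S K]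
    [AddCommGroup N] [Module S N] (hK : HasDegreewiseFiniteResolution S K) :
    Function.Bijective (theta S K N) := by
  obtain ⟨P, hP⟩ := hK
  have hproj : ∀ n, Module.Projective S (P.complex.X n) := fun n =>
    (IsProjective.iff_projective _).2 (P.projective n)
  have hθ := fun n => theta_bijective_of_projective S (P.complex.X n) N
  exact theta_bijective_of_presentation N (d := (P.complex.d 1 0).hom) (π := (P.π.f 0).hom)
    ((ShortComplex.ShortExact.moduleCat_exact_iff_function_exact _).1 P.exact₀)
    ((ModuleCat.epi_iff_surjective (P.π.f 0)).1 inferInstance) (hθ 1) (hθ 0)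

/-- Tor is derived in its first variable, so invariance in the second is checked on the complexes `P
⊗ M` and `P ⊗ M'`. -/
theorem isZero_torGroup_congr (R : Type u) [Ring R] (K : Type u) {M M' : Type u} [AddCommGroup K]
    [Module Rᵐᵒᵖ K] [AddCommGroup M] [Module R M] [AddCommGroup M'] [Module R M'] (e : M ≃ₗ[R] M')
    (i : ℕ) :
    Limits.IsZero (TorGroup R K M (i + 1)) ↔ Limits.IsZero (TorGroup R K M' (i + 1)) := by
  let P := projectiveResolution (ModuleCat.of Rᵐᵒᵖ K)
  rw [isZero_torGroup_iff R K M P, isZero_torGroup_iff R K M' P]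
  have h : ∀ {X Y : Type u} [AddCommGroup X] [Module Rᵐᵒᵖ X] [AddCommGroup Y] [Module Rᵐᵒᵖ Y]
      (f : X →ₗ[Rᵐᵒᵖ] Y) (x : BTensor R X M),
      lmap R Y (e : M →ₗ[R] M') (BTensor.map M f x) =
        BTensor.map M' f (lmap R X (e : M →ₗ[R] M') x) := fun f =>
    DFunLike.congr_fun (BTensor.hom_ext (f := (lmap R _ (e : M →ₗ[R] M')).comp (BTensor.map M f))
      (g := (BTensor.map M' f).comp (lmap R _ (e : M →ₗ[R] M'))) fun _ _ => rfl)
  exact exact_iff_of_bijective (lmap_bijective R _ e) (lmap_bijective R _ e)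
    (lmap_bijective R _ e) (h _) (h _)

theorem subsingleton_extGroup_congr (K : Type u) {N N' : Type u} [AddCommGroup K]
    [Module S K] [AddCommGroup N] [Module S N] [AddCommGroup N'] [Module S N'] (e : N ≃ₗ[S] N')
    (i : ℕ) :
    Subsingleton (ExtGroup S K N (i + 1)) ↔ Subsingleton (ExtGroup S K N' (i + 1)) := by
  let P := projectiveResolution (ModuleCat.of S K)
  rw [subsingleton_extGroup_iff S K N P, subsingleton_extGroup_iff S K N' P]
  have h : ∀ (X : Type u) [AddCommGroup X] [Module S X], Function.Bijective
      (AddMonoidHom.mk' (fun f : X →ₗ[S] N => (e : N →ₗ[S] N').comp f) fun f g =>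
        LinearMap.comp_add f g _) := fun X _ _ =>
    Function.bijective_iff_has_inverse.2 ⟨fun f => (e.symm : N' →ₗ[S] N).comp f,
      fun f => LinearMap.ext fun x => e.symm_apply_apply _,
      fun f => LinearMap.ext fun x => e.apply_symm_apply _⟩
  exact exact_iff_of_bijective (h _) (h _) (h _) (fun _ => rfl) (fun _ => rfl)

end Derived

/-! ### Duality of the evaluation maps -/

section Evaluation

variable {S R K : Type u} [Ring S] [Ring R] [AddCommGroup K] [Module S K]
  [Module Rᵐᵒᵖ K] [SMulCommClass S Rᵐᵒᵖ K]

variable (S R K) in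
/-- The adjunction isomorphism `(K ⊗_R M)^* ≃ Hom_{R^op}(K, M^*)` of right `S`-modules. -/
noncomputable def curryEquiv (M : Type u) [AddCommGroup M] [Module R M] :
    CharacterModule (BTensor R K M) ≃ₗ[Sᵐᵒᵖ] BHom Rᵐᵒᵖ K (CharacterModule M) :=
  LinearEquiv.ofBijective
    ({ toFun := curry R K M
       map_add' := map_add (curry R K M)
       map_smul' := fun _ _ => rfl } :
      CharacterModule (BTensor R K M) →ₗ[Sᵐᵒᵖ] BHom Rᵐᵒᵖ K (CharacterModule M))
    (curry_bijective R K M)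

/-- The tensor evaluation isomorphism `K ⊗_{S^op} N^* ≃ Hom_S(K, N)^*` of right `R`-modules. -/
noncomputable def thetaEquiv (hK : HasDegreewiseFiniteResolution S K) (N : Type u) [AddCommGroup N]
    [Module S N] :
    BTensor Sᵐᵒᵖ K (CharacterModule N) ≃ₗ[Rᵐᵒᵖ] CharacterModule (BHom S K N) :=
  LinearEquiv.ofBijective
    (let t : BTensor Sᵐᵒᵖ K (CharacterModule N) →+ CharacterModule (BHom S K N) := theta S K N
     { toFun := t
       map_add' := map_add t
       map_smul' := fun r x => by
        change t (r • x) = r • t x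
        induction x using BTensor.induction_on with
        | h0 => rw [smul_zero, map_zero, smul_zero]
        | ht k c => rfl
        | ha x y hx hy => rw [smul_add, map_add, map_add, smul_add, hx, hy] } :
      BTensor Sᵐᵒᵖ K (CharacterModule N) →ₗ[Rᵐᵒᵖ] CharacterModule (BHom S K N))
    (theta_bijective S N hK)

/-- `ν_{M^*}` is bijective if and only if `μ_M` is. -/
theorem evalNu_characterModule_bijective_iff (hK : HasDegreewiseFiniteResolution S K) (M : Type u)
    [AddCommGroup M] [Module R M] :
    Function.Bijective (evalNu Rᵐᵒᵖ Sᵐᵒᵖ K (CharacterModule M)) ↔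
      Function.Bijective (evalMu S R K M) := by
  -- The square commutes on pure tensors: both ways send `k ⊗ c` to `m ↦ c (k ⊗ m)`.
  have h : (evalNu Rᵐᵒᵖ Sᵐᵒᵖ K (CharacterModule M)).toAddMonoidHom.comp
      (lmap Sᵐᵒᵖ K (curryEquiv S R K M).toLinearMap) =
      (dualHom (evalMu S R K M).toAddMonoidHom).comp
        (show _ →+ CharacterModule (BHom S K (BTensor R K M)) from theta S K (BTensor R K M)) :=
    BTensor.hom_ext fun _ _ => rfl
  have h₁ := Function.Bijective.of_comp_iff (evalNu Rᵐᵒᵖ Sᵐᵒᵖ K (CharacterModule M))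
    (lmap_bijective Sᵐᵒᵖ K (curryEquiv S R K M))
  have h₂ := Function.Bijective.of_comp_iff (dualHom (evalMu S R K M).toAddMonoidHom)
    (theta_bijective S (BTensor R K M) hK)
  rw [← h₁]
  exact (iff_of_eq (congrArg Function.Bijective (congrArg DFunLike.coe h))).trans
    (h₂.trans (dualHom_bijective_iff _))

/-- `μ_{N^*}` is bijective if and only if `ν_N` is. -/
theorem evalMu_characterModule_bijective_iff (hK : HasDegreewiseFiniteResolution S K) (N : Type u)
    [AddCommGroup N] [Module S N] :
    Function.Bijective (evalMu Rᵐᵒᵖ Sᵐᵒᵖ K (CharacterModule N)) ↔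
      Function.Bijective (evalNu S R K N) := by
  let θ : BTensor Sᵐᵒᵖ K (CharacterModule N) ≃ₗ[Rᵐᵒᵖ] CharacterModule (BHom S K N) :=
    thetaEquiv hK N
  have hθ : Function.Bijective fun g : BHom Rᵐᵒᵖ K (BTensor Sᵐᵒᵖ K (CharacterModule N)) =>
      (LinearMap.comp (θ : BTensor Sᵐᵒᵖ K (CharacterModule N) →ₗ[Rᵐᵒᵖ] CharacterModule (BHom S K N))
        (g : K →ₗ[Rᵐᵒᵖ] BTensor Sᵐᵒᵖ K (CharacterModule N))) :=
    Function.bijective_iff_has_inverse.2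
      ⟨fun g => LinearMap.comp (θ.symm : CharacterModule (BHom S K N) →ₗ[Rᵐᵒᵖ] _) g,
        fun g => LinearMap.ext fun x => θ.symm_apply_apply _,
        fun g => LinearMap.ext fun x => θ.apply_symm_apply _⟩
  have h₁ := Function.Bijective.of_comp_iff' hθ (evalMu Rᵐᵒᵖ Sᵐᵒᵖ K (CharacterModule N))
  have h₂ := Function.Bijective.of_comp_iff' (curry_bijective R K (BHom S K N))
    (dualHom (evalNu S R K N).toAddMonoidHom)
  rw [← h₁]
  refine Iff.trans (iff_of_eq (congrArg Function.Bijective ?_)) (h₂.trans (dualHom_bijective_iff _))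
  -- Both composites send `c` to `k ↦ (f ↦ c (f k))`.
  rfl

end Evaluation

/-! ### The Auslander and Bass classes -/

section Classes

variable {S R K : Type u} [Ring S] [Ring R] [AddCommGroup K] [Module S K]
  [Module Rᵐᵒᵖ K] [SMulCommClass S Rᵐᵒᵖ K]

theorem forall_one_le_iff {p : ℕ → Prop} : (∀ i, 1 ≤ i → p i) ↔ ∀ i, p (i + 1) :=
  ⟨fun h i => h (i + 1) (Nat.le_add_left 1 i), fun h i hi => by
    obtain ⟨j, rfl⟩ := Nat.exists_eq_add_of_le' hi
    exact h j⟩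

theorem isAuslander_iff (M : Type u) [AddCommGroup M] [Module R M] :
    IsAuslander S R K M ↔ (∀ i, Limits.IsZero (TorGroup R K M (i + 1))) ∧
      (∀ i, Subsingleton (ExtGroup S K (BTensor R K M) (i + 1))) ∧
      Function.Bijective (evalMu S R K M) :=
  ⟨fun h => ⟨forall_one_le_iff.1 h.1, forall_one_le_iff.1 h.2, h.3⟩,
    fun h => ⟨forall_one_le_iff.2 h.1, forall_one_le_iff.2 h.2.1, h.2.2⟩⟩

theorem isBass_iff (N : Type u) [AddCommGroup N] [Module S N] :
    IsBass S R K N ↔ (∀ i, Subsingleton (ExtGroup S K N (i + 1))) ∧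
      (∀ i, Limits.IsZero (TorGroup R K (BHom S K N) (i + 1))) ∧
      Function.Bijective (evalNu S R K N) :=
  ⟨fun h => ⟨forall_one_le_iff.1 h.1, forall_one_le_iff.1 h.2, h.3⟩,
    fun h => ⟨forall_one_le_iff.2 h.1, forall_one_le_iff.2 h.2.1, h.2.2⟩⟩

theorem isAuslander_iff_isBass_characterModule (hK : HasDegreewiseFiniteResolution S K)
    (M : Type u) [AddCommGroup M] [Module R M] :
    IsAuslander S R K M ↔ IsBass Rᵐᵒᵖ Sᵐᵒᵖ K (CharacterModule M) := by
  rw [isAuslander_iff, isBass_iff]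
  refine and_congr (forall_congr' fun i => ?_) (and_congr (forall_congr' fun i => ?_) ?_)
  · exact (subsingleton_extGroup_characterModule_iff R K M i).symm
  -- The Bass condition concerns `Hom_{R^op}(K, M^*)`, which is `(K ⊗_R M)^*` by adjunction.
  · exact (isZero_torGroup_characterModule_iff S (BTensor R K M) hK i).symm.trans
      (isZero_torGroup_congr Sᵐᵒᵖ K (curryEquiv S R K M) i)
  · exact (evalNu_characterModule_bijective_iff hK M).symm

theorem isBass_iff_isAuslander_characterModule (hK : HasDegreewiseFiniteResolution S K)
    (N : Type u) [AddCommGroup N] [Module S N] :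
    IsBass S R K N ↔ IsAuslander Rᵐᵒᵖ Sᵐᵒᵖ K (CharacterModule N) := by
  rw [isAuslander_iff, isBass_iff]
  refine and_congr (forall_congr' fun i => ?_) (and_congr (forall_congr' fun i => ?_) ?_)
  · exact (isZero_torGroup_characterModule_iff S N hK i).symm
  -- The Auslander condition concerns `K ⊗_{S^op} N^*`, which is `Hom_S(K, N)^*` by tensor
  -- evaluation.
  · exact (subsingleton_extGroup_characterModule_iff R K (BHom S K N) i).symm.trans
      (subsingleton_extGroup_congr Rᵐᵒᵖ K (thetaEquiv hK N) i).symm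
  · exact (evalMu_characterModule_bijective_iff hK N).symm

end Classes

end Semidual

theorem mainTheorem6 (R S : Type u) [Ring R] [Ring S] (K : Type u) [AddCommGroup K] [Module S K]
    [Module Rᵐᵒᵖ K] [SMulCommClass S Rᵐᵒᵖ K] (hK : Semidual.IsSemidualizing S R K) :
    (∀ (M : Type u) [AddCommGroup M] [Module R M],
      Semidual.IsAuslander S R K M ↔ Semidual.IsBass Rᵐᵒᵖ Sᵐᵒᵖ K (CharacterModule M)) ∧
    (∀ (N : Type u) [AddCommGroup N] [Module S N],
      Semidual.IsBass S R K N ↔ Semidual.IsAuslander Rᵐᵒᵖ Sᵐᵒᵖ K (CharacterModule N)) :=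
  ⟨fun M _ _ => Semidual.isAuslander_iff_isBass_characterModule hK.left_resolution M,
    fun N _ _ => Semidual.isBass_iff_isAuslander_characterModule hK.left_resolution N⟩
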